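/- Let $T_{n\times m}(s,k)$ be the number of tilings of the rectangle that is $n$ units wide and $m$ units long by $k$ non-overlapping $s\times s$ squares and $nm-ks^2$ unit squares, all placed on the integer grid (tilings that differ by a flip or a rotation are counted as distinct). Let $$T_{n\times m}(s)=\sum_{k=0}^{\lfloor nm/s^2\rfloor}T_{n\times m}(s,k),\qquad T_n(s,z,t)=\sum_{m\ge 0}\sum_{k\ge 0}T_{n\times m}(s,k)\,z^mt^k,\qquad T_n(s,z,1)=\sum_{m\ge 0}T_{n\times m}(s)\,z^m ,$$ as formal power series. Then, for $s=3$ and $n=6,7,8,9$, the following identities of formal power series hold, where $P_n,Q_n,p_n,q_n$ are the polynomials listed below, and $Q_n$ and $q_n$ have constant term $1$: $$T_n(3,z,t)=\frac{P_n(z,t)}{Q_n(z,t)},\qquad T_n(3,z,1)=\frac{p_n(z)}{q_n(z)} .$$ For $n=6$: $$\begin{aligned}P_{6}(z,t)=\;&-z^{2}t+1-z^{3}t^{2}\end{aligned}$$ $$\begin{aligned}Q_{6}(z,t)=\;&-3z^{3}t-z^{4}t^{2}+1-z^{2}t-2z^{3}t^{2}-z+z^{5}t^{3}+z^{6}t^{4}\\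 &\quad +2z^{5}t^{2}+2z^{6}t^{3}\end{aligned}$$ $$\begin{aligned}p_{6}(z)=\;&-z^{2}+1-z^{3}\end{aligned}$$ $$\begin{aligned}q_{6}(z)=\;&-5z^{3}-z^{4}+1-z^{2}-z+3z^{5}+3z^{6}\end{aligned}$$ For $n=7$: $$\begin{aligned}P_{7}(z,t)=\;&z^{6}t^{4}-z^{5}t^{3}-3z^{3}t^{2}-z^{4}t^{2}-z^{2}t+1\end{aligned}$$ $$\begin{aligned}Q_{7}(z,t)=\;&-3z^{9}t^{6}+3z^{8}t^{5}+4z^{7}t^{4}+10z^{6}t^{4}+z^{7}t^{3}+z^{8}t^{4}+2z^{5}t^{3}-4z^{4}t^{2}\\ &\quad -6z^{3}t^{2}+2z^{6}t^{3}-4z^{3}t-z^{2}t-z^{9}t^{5}-z+1\end{aligned}$$ $$\begin{aligned}p_{7}(z)=\;&z^{6}-z^{5}-3z^{3}-z^{4}-z^{2}+1\end{aligned}$$ $$\begin{aligned}q_{7}(z)=\;&-4z^{9}+4z^{8}+5z^{7}+12z^{6}+2z^{5}-4z^{4}-10z^{3}-z^{2}\\ &\quad -z+1\end{aligned}$$ For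 $n=8$: $$\begin{aligned}P_{8}(z,t)=\;&-z^{8}t^{5}+2z^{7}t^{4}+z^{5}t^{3}-6z^{3}t^{2}+1+5z^{6}t^{4}-2z^{2}t-z^{4}t^{2}\\ &\quad +z^{6}t^{3}-z^{9}t^{6}\end{aligned}$$ $$\begin{aligned}Q_{8}(z,t)=\;&6z^{12}t^{8}+6z^{11}t^{7}-13z^{10}t^{6}-31z^{9}t^{6}-7z^{9}t^{5}-7z^{8}t^{5}+2z^{8}t^{4}+13z^{7}t^{4}\\ &\quad +41z^{6}t^{4}+t^{3}z^{7}+4z^{6}t^{3}+13z^{5}t^{3}+z^{5}t^{2}-7z^{4}t^{2}-12z^{3}t^{2}-4z^{3}t\\ &\quad -2z^{2}t+1-z\end{aligned}$$ $$\begin{aligned}p_{8}(z)=\;&-z^{8}+2z^{7}+z^{5}-6z^{3}+1+6z^{6}-2z^{2}-z^{4}\\ &\quad -z^{9}\end{aligned}$$ $$\begin{aligned}q_{8}(z)=\;&6z^{12}+6z^{11}-13z^{10}-38z^{9}-5z^{8}+14z^{7}+45z^{6}+14z^{5}\\ &\quad -7z^{4}-16z^{3}-2z^{2}+1-z\end{aligned}$$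 For $n=9$: $$\begin{aligned}P_{9}(z,t)=\;&1+2z^{8}t^{4}-6z^{10}t^{6}-12z^{3}t^{2}-2z^{2}t+5t^{10}z^{14}-5z^{3}t^{3}-2z^{5}t^{3}\\ &\quad +10z^{6}t^{6}-t^{14}z^{18}+40z^{6}t^{5}-z^{15}t^{15}-19z^{11}t^{9}+32z^{12}t^{10}-50z^{10}t^{8}-53z^{9}t^{7}\\ &\quad -2z^{9}t^{6}+23z^{13}t^{10}+6z^{14}t^{11}+13t^{5}z^{8}+12t^{4}z^{7}-4z^{12}t^{9}-32t^{8}z^{11}+z^{17}t^{16}\\ &\quad -z^{21}t^{19}+3z^{18}t^{17}+z^{19}t^{17}-z^{20}t^{17}+7z^{18}t^{16}+z^{20}t^{18}+5z^{12}t^{12}-19z^{15}t^{14}\\ &\quad -57z^{9}t^{8}-29t^{7}z^{10}+12z^{7}t^{6}-10z^{9}t^{9}+12z^{13}t^{11}+13z^{14}t^{12}-3z^{10}t^{9}+8z^{11}t^{10}\\ &\quad +45z^{12}t^{11}-5z^{14}t^{13}-2z^{13}t^{12}-4z^{4}t^{2}+40z^{7}t^{5}+8z^{8}t^{6}+32z^{6}t^{4}+4z^{9}t^{5}\\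 &\quad -7z^{4}t^{3}+5z^{5}t^{4}-7z^{8}t^{7}+2t^{3}z^{6}+5t^{14}z^{17}+t^{13}z^{17}-14t^{13}z^{15}+t^{14}z^{16}\\ &\quad +t^{15}z^{18}-4t^{13}z^{16}+2t^{11}z^{15}+2t^{12}z^{15}-4z^{17}t^{15}-4z^{13}t^{9}-4z^{11}t^{7}-t^{8}z^{12}\end{aligned}$$ $$\begin{aligned}Q_{9}(z,t)=\;&1+14z^{8}t^{4}-110z^{10}t^{6}-22z^{3}t^{2}+34t^{9}z^{14}-2z^{2}t+264t^{10}z^{14}-6z^{3}t^{3}\\ &\quad -5z^{3}t+52t^{8}z^{13}+29t^{11}z^{16}+13z^{5}t^{3}+15z^{6}t^{6}-19t^{14}z^{18}+6t^{10}z^{15}-z\\ &\quad +2z^{9}t^{4}-3z^{21}t^{20}-z^{23}t^{21}-6z^{23}t^{20}-6z^{22}t^{19}+7z^{24}t^{21}+7z^{21}t^{16}-5z^{21}t^{17}\\ &\quad +7z^{23}t^{19}+3z^{16}t^{15}-7z^{20}t^{15}+96z^{6}t^{5}-6z^{15}t^{15}+34z^{11}t^{9}+526z^{12}t^{10}-238z^{10}t^{8}\\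 &\quad +z^{18}t^{18}-38t^{12}z^{17}-435z^{9}t^{7}-2z^{5}t^{2}-282z^{9}t^{6}+446z^{13}t^{10}+190z^{14}t^{11}+70t^{5}z^{8}\\ &\quad +84t^{4}z^{7}+417z^{12}t^{9}-120t^{8}z^{11}-36z^{20}t^{16}-z^{22}t^{20}-51z^{21}t^{18}+6z^{17}t^{16}-29z^{21}t^{19}\\ &\quad +29z^{18}t^{17}-3z^{19}t^{17}+21z^{20}t^{17}+153z^{18}t^{16}-2z^{20}t^{18}+15z^{12}t^{12}-99z^{15}t^{14}-z^{20}t^{19}\\ &\quad +z^{24}t^{22}-15t^{13}z^{18}-176z^{9}t^{8}-431t^{7}z^{10}+z^{19}t^{14}+27z^{7}t^{6}-20z^{9}t^{9}+114z^{13}t^{11}\\ &\quad -25z^{14}t^{12}-23z^{10}t^{9}+15z^{11}t^{10}+175z^{12}t^{11}-13z^{14}t^{13}+2z^{13}t^{12}-12z^{4}t^{2}+145z^{7}t^{5}\\ &\quad -28z^{8}t^{6}+142z^{6}t^{4}-38z^{12}t^{7}-23z^{11}t^{6}+4z^{7}t^{3}-z^{9}t^{5}-8z^{4}t^{3}+7z^{5}t^{4}\\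 &\quad -12z^{8}t^{7}+4t^{3}z^{6}-102t^{14}z^{17}-165t^{12}z^{16}-42t^{13}z^{17}-371t^{13}z^{15}+4t^{14}z^{16}+98t^{15}z^{18}\\ &\quad -4t^{16}z^{19}+25t^{15}z^{19}-122t^{13}z^{16}+14t^{11}z^{15}-211t^{12}z^{15}+18z^{17}t^{15}+254z^{13}t^{9}-147z^{11}t^{7}\\ &\quad -t^{8}z^{12}+4t^{5}z^{10}\end{aligned}$$ $$\begin{aligned}p_{9}(z)=\;&10z^{18}-30z^{15}-47z^{11}+19z^{14}+3z^{5}+84z^{6}+16z^{8}-88z^{10}\\ &\quad -17z^{3}-2z^{2}-z^{21}+1+z^{19}+3z^{17}+29z^{13}+64z^{7}\\ &\quad +77z^{12}-118z^{9}-11z^{4}-3z^{16}\end{aligned}$$ $$\begin{aligned}q_{9}(z)=\;&247z^{18}-667z^{15}-241z^{11}+450z^{14}+18z^{5}+257z^{6}+44z^{8}-798z^{10}\\ &\quad -33z^{3}-2z^{2}-81z^{21}+8z^{24}+1-z+19z^{19}-25z^{20}\\ &\quad -158z^{17}+868z^{13}+260z^{7}+1094z^{12}-912z^{9}-20z^{4}-251z^{16}-7z^{22}\end{aligned}$$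 -/

import Mathlib

namespace SquareTiling

/-- A square tile on the integer grid: its lower left corner `(x, y)` and its edge length. -/
@[ext]
structure Tile where
  x : ℕ
  y : ℕ
  side : ℕ

/-- The unit cells covered by a tile; a cell is named by its lower left corner. -/
def Tile.cells (q : Tile) : Finset (ℕ × ℕ) :=
  Finset.Ico q.x (q.x + q.side) ×ˢ Finset.Ico q.y (q.y + q.side)

/-- The unit cells of the rectangle that is `n` units wide and `m` units long. -/
def rect (n m : ℕ) : Finset (ℕ × ℕ) :=
  Finset.range n ×ˢ Finset.range m

/-- `P` is a tiling of the `n × m` rectangle by `1 × 1` squares and `s × s` squares: all tiles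
have edge length `1` or `s`, lie inside the rectangle, do not overlap, and together cover every
cell. -/
structure IsTiling (n m s : ℕ) (P : Finset Tile) : Prop where
  side_eq : ∀ q ∈ P, q.side = 1 ∨ q.side = s
  subset_rect : ∀ q ∈ P, q.cells ⊆ rect n m
  disjoint : ∀ q ∈ P, ∀ r ∈ P, q ≠ r → Disjoint q.cells r.cells
  cover : ∀ c ∈ rect n m, ∃ q ∈ P, c ∈ q.cells

/-- The tilings of the `n × m` rectangle by `1 × 1` and `s × s` squares that use exactly `k` squares
of edge length `s`. For `s ≥ 2` the remaining tiles are monomers, and by comparison of areas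
there are `n m - k s ^ 2` of them. Tilings that differ by a symmetry of the rectangle are
different elements. -/
def tilings (n m s k : ℕ) : Set (Finset Tile) :=
  {P | IsTiling n m s P ∧ (P.filter (fun q => q.side = s)).card = k}

/-- There are finitely many tilings, so that counting them by `Set.ncard` is meaningful. -/
theorem tilings_finite (n m s k : ℕ) (hs : 0 < s) : (tilings n m s k).Finite := by
  have hfin : {q : Tile | q.x < n ∧ q.y < m ∧ q.side ≤ max 1 s}.Finite := by
    refine Set.Finite.of_injOn (f := fun q : Tile => (q.x, q.y, q.side))
      (t := ((Finset.range n ×ˢ Finset.range m ×ˢ Finset.range (max 1 s + 1) :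
        Finset (ℕ × ℕ × ℕ)) : Set (ℕ × ℕ × ℕ))) ?_ ?_ (Finset.finite_toSet _)
    · rintro q ⟨h1, h2, h3⟩
      simp only [Finset.coe_product, Finset.coe_range, Set.mem_prod, Set.mem_Iio]
      exact ⟨h1, h2, Nat.lt_succ_of_le h3⟩
    · rintro q - r - h
      simp only [Prod.mk.injEq] at h
      exact Tile.ext h.1 h.2.1 h.2.2
  refine Set.Finite.subset (Set.Finite.preimage (f := fun P : Finset Tile => (P : Set Tile))
    (Finset.coe_injective.injOn) hfin.finite_subsets) ?_
  rintro P ⟨hP, -⟩ q hq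
  have hside := hP.side_eq q hq
  have hc : (q.x, q.y) ∈ q.cells := by
    simp only [Tile.cells, Finset.mem_product, Finset.mem_Ico]
    omega
  have hr := hP.subset_rect q hq hc
  simp only [rect, Finset.mem_product, Finset.mem_range] at hr
  exact ⟨hr.1, hr.2, by omega⟩

/-- `T n m s k` is the number of ways of tiling the `n × m` rectangle with `k` non-overlapping
`s × s` squares and with unit squares. -/
noncomputable def T (n m s k : ℕ) : ℕ :=
  (tilings n m s k).ncard

/-- The row sum: the number of ways of tiling the `n × m` rectangle with `1 × 1` and `s × s`
squares. -/
noncomputable def rowSum (n m s : ℕ) : ℕ :=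
  ∑ k ∈ Finset.range (n * m / s ^ 2 + 1), T n m s k

/-- The bivariate generating function `∑ m, ∑ k, T n m s k * z ^ m * t ^ k`, a formal power series in
`z` (the variable with index `0`) and `t` (the variable with index `1`). -/
noncomputable def genFun (n s : ℕ) : MvPowerSeries (Fin 2) ℚ :=
  fun e => (T n (e 0) s (e 1) : ℚ)

/-- The generating function `∑ m, rowSum n m s * z ^ m` of the row sums, that is, the bivariate
generating function at `t = 1`. -/
noncomputable def rowSumGenFun (n s : ℕ) : PowerSeries ℚ :=
  PowerSeries.mk fun m => (rowSum n m s : ℚ)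

/-! ### The explicit numerators and denominators

They are polynomial expressions with integer coefficients, written for elements `z`, `t` (or `w`)
of any commutative ring; they are used with the variables of power series rings. Long expressions
are cut into several sums. -/

/-- The numerator of the bivariate generating function for width `6`. -/
def num6 {R : Type*} [CommRing R] (z t : R) : R :=
  -z^2*t + 1 - z^3*t^2

/-- The denominator of the bivariate generating function for width `6`. -/
def den6 {R : Type*} [CommRing R] (z t : R) : R :=
  -3*z^3*t - z^4*t^2 + 1 - z^2*t - 2*z^3*t^2 - z + z^5*t^3 + z^6*t^4 + 2*z^5*t^2
    + 2*z^6*t^3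

/-- The numerator of the row sum generating function for width `6`. -/
def rowNum6 {R : Type*} [CommRing R] (w : R) : R :=
  -w^2 + 1 - w^3

/-- The denominator of the row sum generating function for width `6`. -/
def rowDen6 {R : Type*} [CommRing R] (w : R) : R :=
  -5*w^3 - w^4 + 1 - w^2 - w + 3*w^5 + 3*w^6

/-- The numerator of the bivariate generating function for width `7`. -/
def num7 {R : Type*} [CommRing R] (z t : R) : R :=
  z^6*t^4 - z^5*t^3 - 3*z^3*t^2 - z^4*t^2 - z^2*t + 1

/-- The denominator of the bivariate generating function for width `7`. -/
def den7 {R : Type*} [CommRing R] (z t : R) : R :=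
  -3*z^9*t^6 + 3*z^8*t^5 + 4*z^7*t^4 + 10*z^6*t^4 + z^7*t^3 + z^8*t^4 + 2*z^5*t^3
    - 4*z^4*t^2 - 6*z^3*t^2 + 2*z^6*t^3 - 4*z^3*t - z^2*t - z^9*t^5 - z + 1

/-- The numerator of the row sum generating function for width `7`. -/
def rowNum7 {R : Type*} [CommRing R] (w : R) : R :=
  w^6 - w^5 - 3*w^3 - w^4 - w^2 + 1

/-- The denominator of the row sum generating function for width `7`. -/
def rowDen7 {R : Type*} [CommRing R] (w : R) : R :=
  -4*w^9 + 4*w^8 + 5*w^7 + 12*w^6 + 2*w^5 - 4*w^4 - 10*w^3 - w^2 - w + 1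

/-- The numerator of the bivariate generating function for width `8`. -/
def num8 {R : Type*} [CommRing R] (z t : R) : R :=
  -z^8*t^5 + 2*z^7*t^4 + z^5*t^3 - 6*z^3*t^2 + 1 + 5*z^6*t^4 - 2*z^2*t - z^4*t^2
    + z^6*t^3 - z^9*t^6

/-- The denominator of the bivariate generating function for width `8`. -/
def den8 {R : Type*} [CommRing R] (z t : R) : R :=
  6*z^12*t^8 + 6*z^11*t^7 - 13*z^10*t^6 - 31*z^9*t^6 - 7*z^9*t^5 - 7*z^8*t^5 + 2*z^8*t^4
    + 13*z^7*t^4 + 41*z^6*t^4 + t^3*z^7 + 4*z^6*t^3 + 13*z^5*t^3 + z^5*t^2 - 7*z^4*t^2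
    - 12*z^3*t^2 - 4*z^3*t - 2*z^2*t + 1 - z

/-- The numerator of the row sum generating function for width `8`. -/
def rowNum8 {R : Type*} [CommRing R] (w : R) : R :=
  -w^8 + 2*w^7 + w^5 - 6*w^3 + 1 + 6*w^6 - 2*w^2 - w^4 - w^9

/-- The denominator of the row sum generating function for width `8`. -/
def rowDen8 {R : Type*} [CommRing R] (w : R) : R :=
  6*w^12 + 6*w^11 - 13*w^10 - 38*w^9 - 5*w^8 + 14*w^7 + 45*w^6 + 14*w^5 - 7*w^4 - 16*w^3
    - 2*w^2 + 1 - w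

/-- Terms of `num9`, part 1 of 3. -/
def num9a {R : Type*} [CommRing R] (z t : R) : R :=
  1 + 2*z^8*t^4 - 6*z^10*t^6 - 12*z^3*t^2 - 2*z^2*t + 5*t^10*z^14 - 5*z^3*t^3
    - 2*z^5*t^3 + 10*z^6*t^6 - t^14*z^18 + 40*z^6*t^5 - z^15*t^15 - 19*z^11*t^9
    + 32*z^12*t^10 - 50*z^10*t^8 - 53*z^9*t^7 - 2*z^9*t^6 + 23*z^13*t^10 + 6*z^14*t^11
    + 13*t^5*z^8 + 12*t^4*z^7 - 4*z^12*t^9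

/-- Terms of `num9`, part 2 of 3. -/
def num9b {R : Type*} [CommRing R] (z t : R) : R :=
  -32*t^8*z^11 + z^17*t^16 - z^21*t^19 + 3*z^18*t^17 + z^19*t^17 - z^20*t^17
    + 7*z^18*t^16 + z^20*t^18 + 5*z^12*t^12 - 19*z^15*t^14 - 57*z^9*t^8 - 29*t^7*z^10
    + 12*z^7*t^6 - 10*z^9*t^9 + 12*z^13*t^11 + 13*z^14*t^12 - 3*z^10*t^9 + 8*z^11*t^10
    + 45*z^12*t^11 - 5*z^14*t^13 - 2*z^13*t^12 - 4*z^4*t^2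

/-- Terms of `num9`, part 3 of 3. -/
def num9c {R : Type*} [CommRing R] (z t : R) : R :=
  40*z^7*t^5 + 8*z^8*t^6 + 32*z^6*t^4 + 4*z^9*t^5 - 7*z^4*t^3 + 5*z^5*t^4 - 7*z^8*t^7
    + 2*t^3*z^6 + 5*t^14*z^17 + t^13*z^17 - 14*t^13*z^15 + t^14*z^16 + t^15*z^18
    - 4*t^13*z^16 + 2*t^11*z^15 + 2*t^12*z^15 - 4*z^17*t^15 - 4*z^13*t^9 - 4*z^11*t^7
    - t^8*z^12

/-- The numerator of the bivariate generating function for width `9`. -/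
def num9 {R : Type*} [CommRing R] (z t : R) : R :=
  num9a z t + num9b z t + num9c z t

/-- Terms of `den9`, part 1 of 4. -/
def den9a {R : Type*} [CommRing R] (z t : R) : R :=
  1 + 14*z^8*t^4 - 110*z^10*t^6 - 22*z^3*t^2 + 34*t^9*z^14 - 2*z^2*t + 264*t^10*z^14
    - 6*z^3*t^3 - 5*z^3*t + 52*t^8*z^13 + 29*t^11*z^16 + 13*z^5*t^3 + 15*z^6*t^6
    - 19*t^14*z^18 + 6*t^10*z^15 - z + 2*z^9*t^4 - 3*z^21*t^20 - z^23*t^21 - 6*z^23*t^20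
    - 6*z^22*t^19 + 7*z^24*t^21 + 7*z^21*t^16 - 5*z^21*t^17 + 7*z^23*t^19

/-- Terms of `den9`, part 2 of 4. -/
def den9b {R : Type*} [CommRing R] (z t : R) : R :=
  3*z^16*t^15 - 7*z^20*t^15 + 96*z^6*t^5 - 6*z^15*t^15 + 34*z^11*t^9 + 526*z^12*t^10
    - 238*z^10*t^8 + z^18*t^18 - 38*t^12*z^17 - 435*z^9*t^7 - 2*z^5*t^2 - 282*z^9*t^6
    + 446*z^13*t^10 + 190*z^14*t^11 + 70*t^5*z^8 + 84*t^4*z^7 + 417*z^12*t^9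
    - 120*t^8*z^11 - 36*z^20*t^16 - z^22*t^20 - 51*z^21*t^18 + 6*z^17*t^16 - 29*z^21*t^19
    + 29*z^18*t^17 - 3*z^19*t^17

/-- Terms of `den9`, part 3 of 4. -/
def den9c {R : Type*} [CommRing R] (z t : R) : R :=
  21*z^20*t^17 + 153*z^18*t^16 - 2*z^20*t^18 + 15*z^12*t^12 - 99*z^15*t^14 - z^20*t^19
    + z^24*t^22 - 15*t^13*z^18 - 176*z^9*t^8 - 431*t^7*z^10 + z^19*t^14 + 27*z^7*t^6
    - 20*z^9*t^9 + 114*z^13*t^11 - 25*z^14*t^12 - 23*z^10*t^9 + 15*z^11*t^10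
    + 175*z^12*t^11 - 13*z^14*t^13 + 2*z^13*t^12 - 12*z^4*t^2 + 145*z^7*t^5 - 28*z^8*t^6
    + 142*z^6*t^4 - 38*z^12*t^7

/-- Terms of `den9`, part 4 of 4. -/
def den9d {R : Type*} [CommRing R] (z t : R) : R :=
  -23*z^11*t^6 + 4*z^7*t^3 - z^9*t^5 - 8*z^4*t^3 + 7*z^5*t^4 - 12*z^8*t^7 + 4*t^3*z^6
    - 102*t^14*z^17 - 165*t^12*z^16 - 42*t^13*z^17 - 371*t^13*z^15 + 4*t^14*z^16
    + 98*t^15*z^18 - 4*t^16*z^19 + 25*t^15*z^19 - 122*t^13*z^16 + 14*t^11*z^15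
    - 211*t^12*z^15 + 18*z^17*t^15 + 254*z^13*t^9 - 147*z^11*t^7 - t^8*z^12 + 4*t^5*z^10

/-- The denominator of the bivariate generating function for width `9`. -/
def den9 {R : Type*} [CommRing R] (z t : R) : R :=
  den9a z t + den9b z t + den9c z t + den9d z t

/-- The numerator of the row sum generating function for width `9`. -/
def rowNum9 {R : Type*} [CommRing R] (w : R) : R :=
  10*w^18 - 30*w^15 - 47*w^11 + 19*w^14 + 3*w^5 + 84*w^6 + 16*w^8 - 88*w^10 - 17*w^3
    - 2*w^2 - w^21 + 1 + w^19 + 3*w^17 + 29*w^13 + 64*w^7 + 77*w^12 - 118*w^9 - 11*w^4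
    - 3*w^16

/-- The denominator of the row sum generating function for width `9`. -/
def rowDen9 {R : Type*} [CommRing R] (w : R) : R :=
  247*w^18 - 667*w^15 - 241*w^11 + 450*w^14 + 18*w^5 + 257*w^6 + 44*w^8 - 798*w^10
    - 33*w^3 - 2*w^2 - 81*w^21 + 8*w^24 + 1 - w + 19*w^19 - 25*w^20 - 158*w^17 + 868*w^13
    + 260*w^7 + 1094*w^12 - 912*w^9 - 20*w^4 - 251*w^16 - 7*w^22

end SquareTiling

/-!
A tiling of a rectangle by unit squares and `3 × 3` squares is the same thing as a packing of the
rectangle by disjoint `3 × 3` squares, since the unit squares fill the rest in exactly one way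
(`T_eq_card_packings`). Packings are counted by a transfer operator. Consider the region above a
skyline. Its leftmost lowest cell can only be covered by the square of which it is the lower left
corner, so the packings fall into two classes, each of which is the set of packings above a higher
skyline (`packPoly_eq_erase_add`). Doing this for all cells of one row gives an operator `rowOp` on
functions of skylines (`skylinePoly_append_eq_rowOp`), and the generating functions `F l` of the
packings above the skylines `l` solve the linear system `F l = flat l + z * rowOp t l F`
(`isTransferSolution_seriesHom`, and `isTransferSolution_rowSeriesHom` for `t = 1`).

In any commutative ring, this system forces `den * F 0ⁿ = num`. Write `den = ∑ q j * z ^ j` with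
polynomials `q j` in `t`. Starting from `q 0 * F 0ⁿ`, use the system to replace the current linear
combination of values of `F` by its constant term plus `z` times another linear combination, and add
`q 1 * F 0ⁿ`, `q 2 * F 0ⁿ`, … to what `z` multiplies. This is a long division: the constant terms
that are split off are the coefficients of `num`, and after the last `q j` the remaining combination
is zero. Linear combinations of skylines are stored as tries (`Comb`), and the division is an
explicit computation with integers (`Comb.divides`), whose meaning is given by
`Comb.evalList₂_mul_of_divides`. Taking `t = 1` in the same identities gives the row sums.
-/

namespace SquareTiling

open Polynomial

/-! ### Packings by squares -/

/-- The cells of the `s × s` square with lower left corner `c`. -/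
def block (s : ℕ) (c : ℕ × ℕ) : Finset (ℕ × ℕ) :=
  (Tile.mk c.1 c.2 s).cells

theorem mem_block {s : ℕ} {b c : ℕ × ℕ} :
    c ∈ block s b ↔ (b.1 ≤ c.1 ∧ c.1 < b.1 + s) ∧ b.2 ≤ c.2 ∧ c.2 < b.2 + s := by
  simp [block, Tile.cells]

theorem self_mem_block {s : ℕ} (hs : 0 < s) (c : ℕ × ℕ) : c ∈ block s c := by
  simp [mem_block, hs]

/-- `B` is the set of lower left corners of pairwise disjoint `s × s` squares inside `R`. -/
structure IsPacking (s : ℕ) (R B : Finset (ℕ × ℕ)) : Prop where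
  subset : ∀ b ∈ B, block s b ⊆ R
  disjoint : ∀ b ∈ B, ∀ c ∈ B, b ≠ c → Disjoint (block s b) (block s c)

open Classical in
/-- The set of all packings of the region `R` by `s × s` squares. -/
noncomputable def packings (s : ℕ) (R : Finset (ℕ × ℕ)) : Finset (Finset (ℕ × ℕ)) :=
  R.powerset.filter (IsPacking s R)

theorem mem_packings {s : ℕ} (hs : 0 < s) {R B : Finset (ℕ × ℕ)} :
    B ∈ packings s R ↔ IsPacking s R B := by
  simp only [packings, Finset.mem_filter, Finset.mem_powerset, and_iff_right_iff_imp]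
  exact fun h b hb => h.subset b hb (self_mem_block hs b)

/-- The packings of `R` counted by their number of squares: the coefficient of `X ^ k` is the number
of packings by `k` squares. -/
noncomputable def packPoly (s : ℕ) (R : Finset (ℕ × ℕ)) : ℚ[X] :=
  ∑ B ∈ packings s R, X ^ B.card

theorem coeff_packPoly (s : ℕ) (R : Finset (ℕ × ℕ)) (k : ℕ) :
    (packPoly s R).coeff k = (((packings s R).filter (fun B => B.card = k)).card : ℚ) := by
  simp [packPoly, Polynomial.coeff_X_pow, eq_comm]

theorem packPoly_empty {s : ℕ} (hs : 0 < s) : packPoly s ∅ = 1 := by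
  have : packings s ∅ = {∅} := by
    ext B
    rw [mem_packings hs, Finset.mem_singleton]
    constructor
    · intro h
      refine Finset.eq_empty_of_forall_notMem fun b hb => ?_
      simpa using h.subset b hb (self_mem_block hs b)
    · rintro rfl
      exact ⟨by simp, by simp⟩
  simp [packPoly, this]

open Classical in
/-- The cell recursion. If `c` can be covered only by the square whose lower left corner it is, then
a packing either leaves `c` uncovered or contains that square. -/
theorem packPoly_eq_erase_add {s : ℕ} (hs : 0 < s) {R : Finset (ℕ × ℕ)} {c : ℕ × ℕ}
    (h : ∀ b, c ∈ block s b → block s b ⊆ R → b = c) :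
    packPoly s R = packPoly s (R.erase c) +
      if block s c ⊆ R then X * packPoly s (R \ block s c) else 0 := by
  have hsplit := (Finset.sum_filter_not_add_sum_filter (packings s R) (fun B => c ∈ B)
    (fun B => (X : ℚ[X]) ^ B.card)).symm
  have h1 : (packings s R).filter (fun B => c ∉ B) = packings s (R.erase c) := by
    ext B
    rw [Finset.mem_filter, mem_packings hs, mem_packings hs]
    constructor
    · rintro ⟨hB, hc⟩
      refine ⟨fun b hb => Finset.subset_erase.2 ⟨hB.subset b hb, fun hcb => hc ?_⟩, hB.disjoint⟩
      rwa [← h b hcb (hB.subset b hb)]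
    · intro hB
      refine ⟨⟨fun b hb => (hB.subset b hb).trans (Finset.erase_subset _ _), hB.disjoint⟩,
        fun hc => ?_⟩
      exact Finset.notMem_erase c R (hB.subset c hc (self_mem_block hs c))
  rw [packPoly, hsplit, h1]
  congr 1
  split_ifs with hc
  · rw [packPoly, Finset.mul_sum]
    have hnot : ∀ B, IsPacking s (R \ block s c) B → c ∉ B := fun B hB hcB =>
      (Finset.mem_sdiff.1 (hB.subset c hcB (self_mem_block hs c))).2 (self_mem_block hs c)
    refine Finset.sum_bij' (fun B _ => B.erase c) (fun B _ => insert c B) ?_ ?_ ?_ ?_ ?_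
    · intro B hB
      rw [Finset.mem_filter, mem_packings hs] at hB
      rw [mem_packings hs]
      refine ⟨fun b hb => ?_, fun b hb d hd => hB.1.disjoint b (Finset.mem_of_mem_erase hb) d
        (Finset.mem_of_mem_erase hd)⟩
      rw [Finset.mem_erase] at hb
      exact Finset.subset_sdiff.2 ⟨hB.1.subset b hb.2, hB.1.disjoint b hb.2 c hB.2 hb.1⟩
    · intro B hB
      rw [mem_packings hs] at hB
      rw [Finset.mem_filter, mem_packings hs]
      have hd : ∀ b ∈ B, Disjoint (block s b) (block s c) := fun b hb =>
        (Finset.subset_sdiff.1 (hB.subset b hb)).2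
      refine ⟨⟨fun b hb => ?_, fun b hb d hd' hbd => ?_⟩, Finset.mem_insert_self _ _⟩
      · rcases Finset.mem_insert.1 hb with rfl | hb
        · exact hc
        · exact (hB.subset b hb).trans Finset.sdiff_subset
      · rcases Finset.mem_insert.1 hb with hb | hb <;> rcases Finset.mem_insert.1 hd' with hd' | hd'
        · exact absurd (hb.trans hd'.symm) hbd
        · exact hb ▸ (hd d hd').symm
        · exact hd' ▸ hd b hb
        · exact hB.disjoint b hb d hd' hbd
    · intro B hB
      exact Finset.insert_erase (Finset.mem_filter.1 hB).2
    · intro B hB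
      exact Finset.erase_insert (hnot B ((mem_packings hs).1 hB))
    · intro B hB
      have hcB := (Finset.mem_filter.1 hB).2
      rw [← pow_succ', Finset.card_erase_add_one hcB]
  · refine Finset.sum_eq_zero fun B hB => absurd ?_ hc
    rw [Finset.mem_filter, mem_packings hs] at hB
    exact hB.1.subset c hB.2

/-! ### Tilings as packings -/

open Classical in
/-- The tiling obtained from a set `B` of corners of `s × s` squares by filling up the rectangle
with unit squares. -/
noncomputable def fillUp (n m s : ℕ) (B : Finset (ℕ × ℕ)) : Finset Tile :=
  B.image (fun b => Tile.mk b.1 b.2 s) ∪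
    (rect n m \ B.biUnion (block s)).image (fun c => Tile.mk c.1 c.2 1)

theorem mem_fillUp {n m s : ℕ} {B : Finset (ℕ × ℕ)} {q : Tile} :
    q ∈ fillUp n m s B ↔ (q.side = s ∧ (q.x, q.y) ∈ B) ∨
      (q.side = 1 ∧ (q.x, q.y) ∈ rect n m ∧ ∀ b ∈ B, (q.x, q.y) ∉ block s b) := by
  obtain ⟨x, y, a⟩ := q
  simp only [fillUp, Finset.mem_union, Finset.mem_image, Finset.mem_sdiff, Finset.mem_biUnion,
    Tile.mk.injEq, Prod.exists, not_exists, not_and, Prod.forall]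
  constructor
  · rintro (⟨b, c, h, rfl, rfl, rfl⟩ | ⟨b, c, h, rfl, rfl, rfl⟩)
    · exact Or.inl ⟨rfl, h⟩
    · exact Or.inr ⟨rfl, h⟩
  · rintro (⟨rfl, h⟩ | ⟨rfl, h⟩)
    · exact Or.inl ⟨x, y, h, rfl, rfl, rfl⟩
    · exact Or.inr ⟨x, y, h, rfl, rfl, rfl⟩

theorem cells_side_one {q : Tile} (h : q.side = 1) : q.cells = {(q.x, q.y)} := by
  ext ⟨a, b⟩
  simp only [Tile.cells, h, Finset.mem_product, Finset.mem_Ico, Finset.mem_singleton,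
    Prod.mk.injEq]
  omega

theorem cells_side_eq {q : Tile} {s : ℕ} (h : q.side = s) : q.cells = block s (q.x, q.y) := by
  subst h; rfl

theorem filter_side_fillUp {n m s : ℕ} (hs : 2 ≤ s) (B : Finset (ℕ × ℕ)) :
    ((fillUp n m s B).filter (fun q => q.side = s)).card = B.card := by
  refine Finset.card_bij' (fun q _ => (q.x, q.y)) (fun b _ => Tile.mk b.1 b.2 s) ?_ ?_ ?_ ?_
  · intro q hq
    rw [Finset.mem_filter, mem_fillUp] at hq
    rcases hq with ⟨h | h, h'⟩
    · exact h.2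
    · omega
  · intro b hb
    exact Finset.mem_filter.2 ⟨mem_fillUp.2 (Or.inl ⟨rfl, hb⟩), rfl⟩
  · intro q hq
    ext
    · rfl
    · rfl
    · exact (Finset.mem_filter.1 hq).2.symm
  · intro b hb
    rfl

theorem isTiling_fillUp {n m s : ℕ} {B : Finset (ℕ × ℕ)}
    (hB : IsPacking s (rect n m) B) : IsTiling n m s (fillUp n m s B) where
  side_eq q hq := by
    rcases mem_fillUp.1 hq with h | h
    · exact Or.inr h.1
    · exact Or.inl h.1
  subset_rect q hq := by
    rcases mem_fillUp.1 hq with h | h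
    · rw [cells_side_eq h.1]
      exact hB.subset _ h.2
    · rw [cells_side_one h.1]
      exact Finset.singleton_subset_iff.2 h.2.1
  disjoint q hq r hr hqr := by
    have hne : q.side = r.side → (q.x, q.y) ≠ (r.x, r.y) := fun h1 h2 => by
      rw [Prod.mk.injEq] at h2
      exact hqr (Tile.ext h2.1 h2.2 h1)
    rcases mem_fillUp.1 hq with h | h <;> rcases mem_fillUp.1 hr with h' | h'
    · rw [cells_side_eq h.1, cells_side_eq h'.1]
      exact hB.disjoint _ h.2 _ h'.2 (hne (h.1.trans h'.1.symm))
    · rw [cells_side_eq h.1, cells_side_one h'.1]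
      exact Finset.disjoint_singleton_right.2 (h'.2.2 _ h.2)
    · rw [cells_side_one h.1, cells_side_eq h'.1]
      exact Finset.disjoint_singleton_left.2 (h.2.2 _ h'.2)
    · rw [cells_side_one h.1, cells_side_one h'.1]
      exact Finset.disjoint_singleton.2 (hne (h.1.trans h'.1.symm))
  cover c hc := by
    by_cases h : ∃ b ∈ B, c ∈ block s b
    · obtain ⟨b, hb, hcb⟩ := h
      exact ⟨⟨b.1, b.2, s⟩, mem_fillUp.2 (Or.inl ⟨rfl, hb⟩), hcb⟩
    · push Not at h
      exact ⟨⟨c.1, c.2, 1⟩, mem_fillUp.2 (Or.inr ⟨rfl, hc, h⟩), self_mem_block one_pos c⟩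

/-- Every tiling is determined by its `s × s` squares. -/
theorem exists_packing_of_isTiling {n m s : ℕ} (hs : 2 ≤ s) {P : Finset Tile}
    (hP : IsTiling n m s P) : ∃ B, IsPacking s (rect n m) B ∧ fillUp n m s B = P := by
  classical
  set B : Finset (ℕ × ℕ) := (P.filter (fun q => q.side = s)).image (fun q => (q.x, q.y)) with hBdef
  have hB : ∀ b : ℕ × ℕ, b ∈ B ↔ Tile.mk b.1 b.2 s ∈ P := by
    intro b
    simp only [hBdef, Finset.mem_image, Finset.mem_filter]
    constructor
    · rintro ⟨⟨x, y, a⟩, ⟨hq, rfl⟩, rfl⟩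
      exact hq
    · intro h
      exact ⟨_, ⟨h, rfl⟩, rfl⟩
  refine ⟨B, ⟨fun b hb => hP.subset_rect _ ((hB b).1 hb), fun b hb c hc hbc =>
    hP.disjoint _ ((hB b).1 hb) _ ((hB c).1 hc) fun h => hbc ?_⟩, ?_⟩
  · rw [Tile.mk.injEq] at h
    exact Prod.ext h.1 h.2.1
  ext ⟨x, y, a⟩
  rw [mem_fillUp]
  simp only [hB]
  constructor
  · rintro (⟨rfl, h⟩ | ⟨rfl, h, hcov⟩)
    · exact h
    · obtain ⟨q, hq, hcq⟩ := hP.cover _ h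
      rcases hP.side_eq q hq with h1 | h1
      · rw [cells_side_one h1, Finset.mem_singleton, Prod.mk.injEq] at hcq
        rwa [show (Tile.mk x y 1) = q from Tile.ext hcq.1 hcq.2 h1.symm]
      · refine absurd ?_ (hcov (q.x, q.y) ?_)
        · rwa [cells_side_eq h1] at hcq
        · rwa [show (Tile.mk q.x q.y s) = q from Tile.ext rfl rfl h1.symm]
  · intro h
    rcases hP.side_eq _ h with h1 | h1
    · have h1' : a = 1 := h1
      subst h1'
      have hmem : (x, y) ∈ (Tile.mk x y 1).cells := self_mem_block one_pos (x, y)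
      refine Or.inr ⟨rfl, hP.subset_rect _ h hmem, fun b hb hxb => ?_⟩
      refine Finset.disjoint_left.1 (hP.disjoint _ h _ hb ?_) hmem hxb
      rw [Ne, Tile.mk.injEq]
      omega
    · have h1' : a = s := h1
      subst h1'
      exact Or.inl ⟨rfl, h⟩

theorem T_eq_card_packings {n m s : ℕ} (hs : 2 ≤ s) (k : ℕ) :
    T n m s k = ((packings s (rect n m)).filter (fun B => B.card = k)).card := by
  rw [← Set.ncard_coe_finset, T]
  symm
  refine Set.ncard_congr (fun B _ => fillUp n m s B) ?_ ?_ ?_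
  · intro B hB
    rw [Finset.mem_coe, Finset.mem_filter, mem_packings (by omega)] at hB
    exact ⟨isTiling_fillUp hB.1, (filter_side_fillUp hs B).trans hB.2⟩
  · intro B C hB hC h
    ext b
    have key : ∀ D : Finset (ℕ × ℕ), Tile.mk b.1 b.2 s ∈ fillUp n m s D ↔ b ∈ D := by
      intro D
      rw [mem_fillUp]
      constructor
      · rintro (h | h)
        · exact h.2
        · have := h.1
          simp only at this
          omega
      · exact fun h => Or.inl ⟨rfl, h⟩
    rw [← key B, ← key C]
    rw [h]
  · rintro P ⟨hP, hk⟩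
    obtain ⟨B, hB, rfl⟩ := exists_packing_of_isTiling hs hP
    refine ⟨B, ?_, rfl⟩
    rw [Finset.mem_coe, Finset.mem_filter, mem_packings (by omega)]
    exact ⟨hB, (filter_side_fillUp hs B).symm.trans hk⟩

/-- The number of `s × s` squares in a packing is bounded by comparison of areas. -/
theorem IsPacking.card_le {n m s : ℕ} (hs : 0 < s) {B : Finset (ℕ × ℕ)}
    (hB : IsPacking s (rect n m) B) : B.card ≤ n * m / s ^ 2 := by
  rw [Nat.le_div_iff_mul_le (by positivity)]
  have h1 : (B.biUnion (block s)).card = B.card * s ^ 2 := by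
    rw [Finset.card_biUnion hB.disjoint, Finset.sum_const_nat]
    intro b _
    simp [block, Tile.cells, sq]
  rw [← h1, show n * m = (rect n m).card by simp [rect]]
  exact Finset.card_le_card (Finset.biUnion_subset.2 hB.subset)

theorem coeff_packPoly_rect {n m s : ℕ} (hs : 2 ≤ s) (k : ℕ) :
    (packPoly s (rect n m)).coeff k = T n m s k := by
  rw [coeff_packPoly, T_eq_card_packings hs]

theorem eval_one_packPoly_rect {n m s : ℕ} (hs : 2 ≤ s) :
    (packPoly s (rect n m)).eval 1 = rowSum n m s := by
  rw [Polynomial.eval_eq_sum_range' (n := n * m / s ^ 2 + 1), rowSum]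
  · simp [coeff_packPoly_rect hs]
  · refine Nat.lt_succ_of_le (Polynomial.natDegree_sum_le_of_forall_le _ _ fun B hB => ?_)
    rw [Polynomial.natDegree_X_pow]
    exact ((mem_packings (by omega)).1 hB).card_le (by omega)

/-! ### The transfer operator -/

/-- The transfer operator of one row. A skyline is a list of numbers, one for each column: how many
cells of the column, counted from the current row on, are covered already. The current row is
processed from left to right: a covered cell just lowers the entry by one, an uncovered cell
becomes a unit square, or three adjacent uncovered cells become the bottom row of a `3 × 3`
square, which has weight `t` and covers two more rows. `rowOp t l F` is the sum over all ways of
processing the row of the weight times the value of `F` at the new skyline. -/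
def rowOp {R : Type*} [CommRing R] (t : R) : List ℕ → (List ℕ → R) → R
  | [], F => F []
  | (v + 1) :: l, F => rowOp t l (fun r => F (v :: r))
  | 0 :: l, F => rowOp t l (fun r => F (0 :: r)) +
      match l with
      | 0 :: 0 :: l' => t * rowOp t l' (fun r => F (2 :: 2 :: 2 :: r))
      | _ => 0

/-- The part of the transfer operator in which a `3 × 3` square starts at an uncovered
column and the word lists the columns to its right. -/
def squareOp {R : Type*} [CommRing R] (t : R) (F : List ℕ → R) : List ℕ → R
  | 0 :: 0 :: l => t * rowOp t l (fun r => F (2 :: 2 :: 2 :: r))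
  | _ => 0

theorem rowOp_zero_cons {R : Type*} [CommRing R] (t : R) (F : List ℕ → R) (l : List ℕ) :
    rowOp t (0 :: l) F = rowOp t l (fun r => F (0 :: r)) + squareOp t F l := by
  rcases l with _ | ⟨_ | v, _ | ⟨_ | w, l⟩⟩ <;> simp [rowOp, squareOp]

theorem squareOp_of_not {R : Type*} [CommRing R] (t : R) (F : List ℕ → R) {l : List ℕ}
    (h : ∀ l', l ≠ 0 :: 0 :: l') : squareOp t F l = 0 := by
  rcases l with _ | ⟨_ | v, _ | ⟨_ | w, l⟩⟩ <;> simp_all [squareOp]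

/-- The indicator function of the flat skyline. -/
def flat {R : Type*} [CommRing R] : List ℕ → R
  | [] => 1
  | 0 :: l => flat l
  | (_ + 1) :: _ => 0

/-- The linear system satisfied by the generating functions `F l` of the tilings above the
skylines `l`. -/
def IsTransferSolution {R : Type*} [CommRing R] (z t : R) (F : List ℕ → R) : Prop :=
  ∀ l, F l = flat l + z * rowOp t l F

/-! ### Polynomials as coefficient lists -/

/-- The value at `t` of the polynomial with the given list of coefficients, lowest degree first. -/
def evalList {R : Type*} [CommRing R] (t : R) : List ℤ → R
  | [] => 0
  | a :: p => a + t * evalList t p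

/-- The value at `(z, t)` of a polynomial in `z` whose coefficients are polynomials in `t`. -/
def evalList₂ {R : Type*} [CommRing R] (z t : R) : List (List ℤ) → R
  | [] => 0
  | p :: q => evalList t p + z * evalList₂ z t q

/-- Addition of coefficient lists. -/
def addList : List ℤ → List ℤ → List ℤ
  | [], q => q
  | a :: p, [] => a :: p
  | a :: p, b :: q => (a + b) :: addList p q

/-- Equality of coefficient lists up to trailing zeros. -/
def eqList : List ℤ → List ℤ → Bool
  | [], q => q.all (· == 0)
  | a :: p, [] => (a == 0) && eqList p []
  | a :: p, b :: q => (a == b) && eqList p q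

section
variable {R : Type*} [CommRing R] (z t : R)

theorem evalList_addList (p q : List ℤ) :
    evalList t (addList p q) = evalList t p + evalList t q := by
  induction p generalizing q with
  | nil => simp [addList, evalList]
  | cons a p ih =>
    cases q with
    | nil => simp [addList, evalList]
    | cons b q =>
      simp only [addList, evalList, ih, Int.cast_add]
      ring

theorem evalList_eq_of_eqList {p q : List ℤ} (h : eqList p q = true) :
    evalList t p = evalList t q := by
  induction p generalizing q with
  | nil =>
    induction q with
    | nil => rfl
    | cons b q ih =>
      simp only [eqList, List.all_cons, Bool.and_eq_true, beq_iff_eq] at h ih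
      simp [evalList, h.1, ← ih h.2]
  | cons a p ih =>
    cases q with
    | nil =>
      simp only [eqList, Bool.and_eq_true, beq_iff_eq] at h
      simp [evalList, h.1, ih h.2]
    | cons b q =>
      simp only [eqList, Bool.and_eq_true, beq_iff_eq] at h
      simp [evalList, h.1, ih h.2]

end

/-! ### Linear combinations of skylines -/

/-- A finite formal linear combination of words over `{0, 1, 2}`, stored as a trie: `node p a b c`
has coefficient `p` at the empty word, and `a`, `b`, `c` collect the words that begin with `0`,
`1`, `2`. -/
inductive Comb where
  | zero : Comb
  | node (p : List ℤ) (a b c : Comb) : Comb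

namespace Comb

/-- The value of a linear combination when each word `l` is replaced by `F l`. -/
def eval {R : Type*} [CommRing R] (t : R) : Comb → (List ℕ → R) → R
  | zero, _ => 0
  | node p a b c, F => evalList t p * F [] + a.eval t (fun l => F (0 :: l)) +
      b.eval t (fun l => F (1 :: l)) + c.eval t (fun l => F (2 :: l))

/-- Addition of linear combinations. -/
def add : Comb → Comb → Comb
  | zero, y => y
  | node p a b c, zero => node p a b c
  | node p a b c, node p' a' b' c' =>
      node (addList p p') (add a a') (add b b') (add c c')

/-- Multiplication of a linear combination by `t`. -/
def shift : Comb → Comb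
  | zero => zero
  | node p a b c => node (0 :: p) a.shift b.shift c.shift

/-- The transpose of the transfer operator: replaces each word by the linear combination of the
words that one row can lead to. -/
def push : Comb → Comb
  | zero => zero
  | node p a b c => node p (add a.push b.push) c.push
      (match a with
        | node _ (node _ d _ _) _ _ =>
          node [] zero zero (node [] zero zero d.push.shift)
        | _ => zero)
termination_by structural x => x

/-- The sum of the coefficients of the words without nonzero letters. -/
def flatPart : Comb → List ℤ
  | zero => []
  | node p a _ _ => addList p a.flatPart

/-- The word of `n` zeros with coefficient `p`. -/
def single (p : List ℤ) : ℕ → Comb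
  | 0 => node p zero zero zero
  | n + 1 => node [] (single p n) zero zero

/-- Whether all coefficients vanish. -/
def isZero : Comb → Bool
  | zero => true
  | node p a b c => eqList p [] && a.isZero && b.isZero && c.isZero

end Comb
/-! ### Packings above a skyline -/

/-- The region above the skyline `s` and below height `M`: the cells `(x, y)` with `s x ≤ y < M`. -/
def region (M : ℕ) (s : List ℕ) : Finset (ℕ × ℕ) :=
  (rect s.length M).filter (fun c => s.getD c.1 0 ≤ c.2)

theorem mem_region {M : ℕ} {s : List ℕ} {c : ℕ × ℕ} :
    c ∈ region M s ↔ (c.1 < s.length ∧ c.2 < M) ∧ s.getD c.1 0 ≤ c.2 := by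
  simp [region, rect]

open Classical in
/-- The packings of the cells above the skyline `s` and below height `M`, counted by their number of
squares. The value is zero when the skyline exceeds `M`, since a square already placed would stick out. -/
noncomputable def skylinePoly (M : ℕ) (s : List ℕ) : ℚ[X] :=
  if ∀ a ∈ s, a ≤ M then packPoly 3 (region M s) else 0

theorem getD_append_eq_ite (P S : List ℕ) (x : ℕ) :
    (P ++ S).getD x 0 = if x < P.length then P.getD x 0 else S.getD (x - P.length) 0 := by
  split_ifs with h
  · exact List.getD_append _ _ _ _ h
  · exact List.getD_append_right _ _ _ _ (not_lt.1 h)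

theorem lt_getD_of_forall_mem {P : List ℕ} {y x : ℕ} (hP : ∀ a ∈ P, y < a) (hx : x < P.length) :
    y < P.getD x 0 := by
  rw [List.getD_eq_getElem _ _ hx]
  exact hP _ (List.getElem_mem hx)

/-- The square at a lowest cell fits above the skyline if and only if the next two columns are level
with that cell and there are three rows left. -/
theorem block_subset_region_iff {M y : ℕ} {P S : List ℕ} (hS : ∀ a ∈ S, y ≤ a) :
    block 3 (P.length, y) ⊆ region M (P ++ y :: S) ↔ y + 3 ≤ M ∧ ∃ S', S = y :: y :: S' := by
  constructor
  · intro h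
    have h1 := mem_region.1 (h (mem_block.2 ⟨⟨Nat.le_add_right _ 1, by simp⟩, le_refl _, by simp⟩ :
      (P.length + 1, y) ∈ block 3 (P.length, y)))
    have h2 := mem_region.1 (h (mem_block.2 ⟨⟨Nat.le_add_right _ 2, by simp⟩,
      Nat.le_add_right _ 2, by simp⟩ : (P.length + 2, y + 2) ∈ block 3 (P.length, y)))
    have h3 := mem_region.1 (h (mem_block.2 ⟨⟨Nat.le_add_right _ 2, by simp⟩, le_refl _, by simp⟩ :
      (P.length + 2, y) ∈ block 3 (P.length, y)))
    rcases S with _ | ⟨a, _ | ⟨b, S⟩⟩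
    · simp at h1
    · simp at h3
    · simp only [getD_append_eq_ite, List.length_append, List.length_cons] at h1 h2 h3
      simp at h1 h2 h3 hS
      refine ⟨by omega, S, ?_⟩
      rw [le_antisymm h1.2 hS.1, le_antisymm h3.2 hS.2.1]
  · rintro ⟨hM, S, rfl⟩ ⟨x, y'⟩ hc
    rw [mem_block] at hc
    simp only at hc
    refine mem_region.2 ⟨⟨by simp; omega, by simp; omega⟩, ?_⟩
    rw [getD_append_eq_ite, if_neg (by simp; omega)]
    obtain h | h | h : x - P.length = 0 ∨ x - P.length = 1 ∨ x - P.length = 2 := by omega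
    all_goals simp [h]; omega

theorem region_erase {M y : ℕ} {P S : List ℕ} :
    (region M (P ++ y :: S)).erase (P.length, y) = region M (P ++ (y + 1) :: S) := by
  ext ⟨x, y'⟩
  rw [Finset.mem_erase, mem_region, mem_region, getD_append_eq_ite, getD_append_eq_ite, Ne,
    Prod.mk.injEq]
  simp only [List.length_append, List.length_cons]
  split_ifs with h
  · omega
  · rcases hk : x - P.length with _ | k
    · simp; omega
    · simp; omega

theorem region_sdiff {M y : ℕ} {P S : List ℕ} :
    region M (P ++ y :: y :: y :: S) \ block 3 (P.length, y) =
      region M (P ++ (y + 3) :: (y + 3) :: (y + 3) :: S) := by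
  ext ⟨x, y'⟩
  rw [Finset.mem_sdiff, mem_region, mem_region, mem_block, getD_append_eq_ite, getD_append_eq_ite]
  simp only [List.length_append, List.length_cons]
  split_ifs with h
  · omega
  · rcases hk : x - P.length with _ | _ | _ | k
    all_goals simp; omega

open Classical in
/-- The cell recursion at the leftmost lowest cell above a skyline. -/
theorem packPoly_region {M y : ℕ} {P S : List ℕ} (hP : ∀ a ∈ P, y < a) (hS : ∀ a ∈ S, y ≤ a) :
    packPoly 3 (region M (P ++ y :: S)) = packPoly 3 (region M (P ++ (y + 1) :: S)) +
      if y + 3 ≤ M ∧ ∃ S', S = y :: y :: S' then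
        X * packPoly 3 (region M (P ++ y :: S) \ block 3 (P.length, y)) else 0 := by
  rw [packPoly_eq_erase_add (c := (P.length, y)) (by norm_num), region_erase]
  · simp only [block_subset_region_iff hS]
  · rintro ⟨u, v⟩ hc hb
    have h0 := mem_region.1 (hb (self_mem_block (by norm_num) (u, v)))
    rw [mem_block] at hc
    simp only [getD_append_eq_ite] at h0 hc
    -- A square that starts further left would contain a cell below the skyline of `P`.
    have hu : u = P.length := by
      by_contra hne
      have hlt : u < P.length := by omega
      rw [if_pos hlt] at h0
      have := lt_getD_of_forall_mem hP hlt
      omega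
    subst hu
    simp at h0
    exact Prod.ext rfl (by simp; omega)

theorem skylinePoly_cons_of_not {M y : ℕ} {P S : List ℕ} (hy : y < M) (hP : ∀ a ∈ P, y < a)
    (hS : ∀ a ∈ S, y ≤ a) (h : ¬ ∃ S', S = y :: y :: S') :
    skylinePoly M (P ++ y :: S) = skylinePoly M (P ++ (y + 1) :: S) := by
  unfold skylinePoly
  rw [packPoly_region hP hS, if_neg (c := _ ∧ _) (fun h' => h h'.2), add_zero]
  have : y ≤ M ↔ y + 1 ≤ M := by omega
  simp only [List.mem_append, List.mem_cons, or_imp, forall_and, forall_eq, this]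

theorem skylinePoly_cons {M y : ℕ} {P S : List ℕ} (hy : y < M) (hP : ∀ a ∈ P, y < a)
    (hS : ∀ a ∈ S, y ≤ a) :
    skylinePoly M (P ++ y :: y :: y :: S) = skylinePoly M (P ++ (y + 1) :: y :: y :: S) +
      X * skylinePoly M (P ++ (y + 3) :: (y + 3) :: (y + 3) :: S) := by
  have hS' : ∀ a ∈ y :: y :: S, y ≤ a := by simpa using hS
  unfold skylinePoly
  rw [packPoly_region hP hS', region_sdiff]
  simp only [List.mem_append, List.mem_cons, or_imp, forall_and, forall_eq]
  by_cases h : (∀ a ∈ P, a ≤ M) ∧ ∀ a ∈ S, a ≤ M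
  -- For `M < y + 3` the square does not fit, and the skyline with entries `y + 3` exceeds `M`.
  · by_cases h3 : y + 3 ≤ M <;>
      simp [eq_true h.1, eq_true h.2, h3, hy.le, Nat.succ_le_of_lt hy]
  · rw [if_neg (by tauto), if_neg (by tauto), if_neg (by tauto)]
    simp

/-- The transfer operator describes one row. The columns of `P` are already processed in the row at
height `y`, those of `l` are not; processing them yields columns of the next skyline. -/
theorem skylinePoly_append_eq_rowOp {M y : ℕ} (hy : y < M) (l : List ℕ) :
    ∀ P : List ℕ, (∀ a ∈ P, y < a) → skylinePoly M (P ++ l.map (· + y)) =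
      rowOp X l (fun r => skylinePoly M (P ++ r.map (· + (y + 1)))) := by
  have hle : ∀ (l : List ℕ), ∀ a ∈ l.map (· + y), y ≤ a := by
    intro l a ha
    obtain ⟨v, -, rfl⟩ := List.mem_map.1 ha
    exact Nat.le_add_left _ _
  have hcons : ∀ {P : List ℕ} (v : ℕ), (∀ a ∈ P, y < a) → ∀ a ∈ P ++ [v + (y + 1)], y < a := by
    intro P v hP a ha
    rcases List.mem_append.1 ha with ha | ha
    · exact hP a ha
    · rw [List.mem_singleton.1 ha]
      omega
  induction hn : l.length using Nat.strong_induction_on generalizing l with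
  | _ n ih =>
  subst hn
  intro P hP
  rcases l with _ | ⟨_ | v, l⟩
  · rfl
  · have h1 := ih _ (by simp) l rfl (P ++ [0 + (y + 1)]) (hcons 0 hP)
    simp only [List.append_assoc, List.cons_append, List.nil_append, List.map_cons, zero_add]
      at h1 ⊢
    rw [rowOp_zero_cons]
    by_cases hl : ∃ l', l = 0 :: 0 :: l'
    · obtain ⟨l, rfl⟩ := hl
      have h2 := ih l.length (by simp; omega) l rfl
        (P ++ [2 + (y + 1)] ++ [2 + (y + 1)] ++ [2 + (y + 1)]) (hcons 2 (hcons 2 (hcons 2 hP)))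
      have e : 2 + (y + 1) = y + 3 := by omega
      simp only [e, List.append_assoc, List.cons_append, List.nil_append, List.map_cons, zero_add]
        at h1 h2 ⊢
      simp only [skylinePoly_cons hy hP (hle l), h1, h2, squareOp, List.map_cons, e]
    · rw [skylinePoly_cons_of_not hy hP (hle l), h1, squareOp_of_not _ _ (by simpa using hl),
        add_zero]
      · simp only [List.map_cons, zero_add]
      · rintro ⟨S', hS'⟩
        rcases l with _ | ⟨a, _ | ⟨b, l⟩⟩ <;> simp at hS'
        exact hl ⟨l, by rw [hS'.1, hS'.2.1]⟩
  · rw [rowOp]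
    have := ih _ (by simp) l rfl (P ++ [v + (y + 1)]) (hcons v hP)
    simpa [add_assoc, add_comm 1 y] using this

/-- The iterates of the transfer operator. The polynomial `skylineCount m l` counts the packings
above the skyline `l` when `m` rows are left. -/
noncomputable def skylineCount : ℕ → List ℕ → ℚ[X]
  | 0, l => flat l
  | m + 1, l => rowOp X l (skylineCount m)

theorem flat_eq_ite {R : Type*} [CommRing R] (l : List ℕ) :
    flat l = if ∀ a ∈ l, a = 0 then (1 : R) else 0 := by
  induction l with
  | nil => simp [flat]
  | cons a l ih => cases a <;> simp [flat, ih]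

theorem skylinePoly_eq_skylineCount {M m y : ℕ} (h : y + m = M) (l : List ℕ) :
    skylinePoly M (l.map (· + y)) = skylineCount m l := by
  induction m generalizing y l with
  | zero =>
    obtain rfl : y = M := h
    have hR : region y (l.map (· + y)) = ∅ := by
      refine Finset.eq_empty_of_forall_notMem fun c hc => ?_
      rw [mem_region, List.length_map] at hc
      rw [List.getD_eq_getElem _ _ (by simpa using hc.1.1), List.getElem_map] at hc
      omega
    rw [skylinePoly, skylineCount, flat_eq_ite]
    by_cases hl : ∀ a ∈ l.map (· + y), a ≤ y
    · rw [if_pos hl, if_pos (by simpa using hl), hR, packPoly_empty (by norm_num)]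
    · rw [if_neg hl, if_neg (by simpa using hl)]
  | succ m ih =>
    have := skylinePoly_append_eq_rowOp (M := M) (y := y) (by omega) l [] (by simp)
    rw [skylineCount]
    simpa only [List.nil_append, ih (show y + 1 + m = M by omega)] using this

/-- The packings of a rectangle are counted by the iterates of the transfer operator. -/
theorem packPoly_rect (n m : ℕ) :
    packPoly 3 (rect n m) = skylineCount m (List.replicate n 0) := by
  rw [← skylinePoly_eq_skylineCount (zero_add m)]
  have hR : region m (List.replicate n 0) = rect n m := by
    ext c
    rw [mem_region]
    simp only [List.length_replicate, rect, Finset.mem_product, Finset.mem_range,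
      and_iff_left_iff_imp]
    intro h
    rw [List.getD_eq_getElem _ _ (by simpa using h.1)]
    simp
  simp [skylinePoly, hR]

/-! ### The generating functions -/

/-- The transfer operator commutes with every additive map from sequences under which multiplication
by `u` becomes multiplication by `t`. -/
theorem map_rowOp {R S : Type*} [CommRing R] [CommRing S] {u : S} {t : R} (φ : (ℕ → S) →+ R)
    (hφ : ∀ f, φ (fun m => u * f m) = t * φ f) (l : List ℕ) (N : ℕ → List ℕ → S) :
    φ (fun m => rowOp u l (N m)) = rowOp t l (fun r => φ (fun m => N m r)) := by
  induction hn : l.length using Nat.strong_induction_on generalizing l N with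
  | _ n ih =>
  subst hn
  rcases l with _ | ⟨_ | v, l⟩
  · rfl
  · have h1 := ih _ (by simp) l (fun m r => N m (0 :: r)) rfl
    simp only [rowOp_zero_cons]
    rw [← h1]
    by_cases hl : ∃ l', l = 0 :: 0 :: l'
    · obtain ⟨l, rfl⟩ := hl
      simp only [squareOp]
      rw [← ih l.length (by simp; omega) l (fun m r => N m (2 :: 2 :: 2 :: r)) rfl, ← hφ, ← map_add]
      rfl
    · simp only [squareOp_of_not _ _ (show ∀ l', l ≠ 0 :: 0 :: l' by simpa using hl), add_zero]
  · exact ih _ (by simp) l (fun m r => N m (v :: r)) rfl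

/-- A sequence of polynomials in `t` as a power series in `z` and `t`. -/
noncomputable def seriesHom : (ℕ → ℚ[X]) →+ MvPowerSeries (Fin 2) ℚ where
  toFun f := fun e => (f (e 0)).coeff (e 1)
  map_zero' := by
    funext e
    exact Polynomial.coeff_zero _
  map_add' f g := by
    funext e
    exact Polynomial.coeff_add _ _ _

theorem coeff_seriesHom (f : ℕ → ℚ[X]) (e : Fin 2 →₀ ℕ) :
    MvPowerSeries.coeff e (seriesHom f) = (f (e 0)).coeff (e 1) := rfl

theorem coeff_X_mul_mvPowerSeries {σ R : Type*} [DecidableEq σ] [CommRing R] (i : σ) (e : σ →₀ ℕ)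
    (f : MvPowerSeries σ R) : MvPowerSeries.coeff e (MvPowerSeries.X i * f) =
      if e i = 0 then 0 else MvPowerSeries.coeff (e - Finsupp.single i 1) f := by
  rw [MvPowerSeries.X, MvPowerSeries.coeff_monomial_mul, one_mul]
  have : Finsupp.single i 1 ≤ e ↔ ¬ e i = 0 := by
    rw [Finsupp.single_le_iff]
    omega
  simp only [this, ite_not]

theorem seriesHom_X_mul (f : ℕ → ℚ[X]) :
    seriesHom (fun m => X * f m) = MvPowerSeries.X 1 * seriesHom f := by
  ext e
  rw [coeff_X_mul_mvPowerSeries, coeff_seriesHom, coeff_seriesHom]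
  rcases h : e 1 with _ | k <;> simp [h]

theorem isTransferSolution_seriesHom : IsTransferSolution (MvPowerSeries.X 0)
    (MvPowerSeries.X 1 : MvPowerSeries (Fin 2) ℚ)
    (fun l => seriesHom (fun m => skylineCount m l)) := by
  intro l
  rw [← map_rowOp seriesHom seriesHom_X_mul]
  ext e
  rw [map_add, coeff_X_mul_mvPowerSeries, coeff_seriesHom, coeff_seriesHom, flat_eq_ite]
  rcases h : e 0 with _ | m
  · have he : e = 0 ↔ e 1 = 0 := by
      rw [Finsupp.ext_iff, Fin.forall_fin_two]
      simp [h]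
    simp only [skylineCount, flat_eq_ite]
    split_ifs <;> simp_all [Polynomial.coeff_one, MvPowerSeries.coeff_one]
  · have he : e ≠ 0 := by
      rintro rfl
      simp at h
    split_ifs <;> simp_all [MvPowerSeries.coeff_one, skylineCount]

/-- A sequence of polynomials in `t` as a power series in `z`, at `t = 1`. -/
noncomputable def rowSeriesHom : (ℕ → ℚ[X]) →+ PowerSeries ℚ where
  toFun f := PowerSeries.mk fun m => (f m).eval 1
  map_zero' := by ext; simp
  map_add' f g := by ext e; simp

theorem isTransferSolution_rowSeriesHom : IsTransferSolution (PowerSeries.X : PowerSeries ℚ) 1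
    (fun l => rowSeriesHom (fun m => skylineCount m l)) := by
  intro l
  rw [← map_rowOp (u := X) rowSeriesHom (fun f => by ext; simp [rowSeriesHom])]
  ext m
  rcases m with _ | m
  · by_cases h : ∀ a ∈ l, a = 0
    · simp [rowSeriesHom, skylineCount, flat_eq_ite, eq_true h]
    · simp [rowSeriesHom, skylineCount, flat_eq_ite, eq_false h]
  · rw [flat_eq_ite]
    split_ifs <;>
      simp [rowSeriesHom, skylineCount, PowerSeries.coeff_one, PowerSeries.coeff_succ_X_mul]

theorem genFun_eq_seriesHom (n : ℕ) :
    genFun n 3 = seriesHom (fun m => skylineCount m (List.replicate n 0)) := by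
  ext e
  rw [coeff_seriesHom, ← packPoly_rect, coeff_packPoly_rect (by norm_num)]
  rfl

theorem rowSumGenFun_eq_rowSeriesHom (n : ℕ) :
    rowSumGenFun n 3 = rowSeriesHom (fun m => skylineCount m (List.replicate n 0)) := by
  ext m
  simp [rowSumGenFun, rowSeriesHom, ← packPoly_rect, eval_one_packPoly_rect]

namespace Comb
section
variable {R : Type*} [CommRing R] (t : R)

theorem eval_add (x y : Comb) (F : List ℕ → R) : (add x y).eval t F = x.eval t F + y.eval t F := by
  induction x generalizing y F with
  | zero => simp [add, eval]
  | node p a b c iha ihb ihc =>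
    cases y with
    | zero => simp [add, eval]
    | node p' a' b' c' =>
      simp only [add, eval, iha, ihb, ihc, evalList_addList]
      ring

theorem eval_shift (x : Comb) (F : List ℕ → R) : x.shift.eval t F = t * x.eval t F := by
  induction x generalizing F with
  | zero => simp [shift, eval]
  | node p a b c iha ihb ihc =>
    simp only [shift, eval, evalList, iha, ihb, ihc, Int.cast_zero]
    ring

theorem eval_fun_zero (x : Comb) : x.eval t (fun _ => 0) = 0 := by
  induction x with
  | zero => rfl
  | node p a b c iha ihb ihc => simp [eval, iha, ihb, ihc]

theorem eval_fun_add (x : Comb) (F G : List ℕ → R) :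
    x.eval t (fun l => F l + G l) = x.eval t F + x.eval t G := by
  induction x generalizing F G with
  | zero => simp [eval]
  | node p a b c iha ihb ihc =>
    simp only [eval, iha, ihb, ihc]
    ring

theorem eval_fun_mul (x : Comb) (r : R) (F : List ℕ → R) :
    x.eval t (fun l => r * F l) = r * x.eval t F := by
  induction x generalizing F with
  | zero => simp [eval]
  | node p a b c iha ihb ihc =>
    simp only [eval, iha, ihb, ihc]
    ring

theorem push_node (p : List ℤ) (a b c : Comb) : (node p a b c).push =
    node p (add a.push b.push) c.push (match a with
      | node _ (node _ d _ _) _ _ =>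
        node [] zero zero (node [] zero zero d.push.shift)
      | _ => zero) := by
  rcases a with _ | ⟨p1, _ | ⟨p2, d, b2, c2⟩, b1, c1⟩ <;> rfl

/-- Pushing a combination forward is dual to applying the transfer operator to a function. -/
theorem eval_push (x : Comb) (F : List ℕ → R) :
    x.push.eval t F = x.eval t (fun l => rowOp t l F) := by
  induction x using push.induct generalizing F with
  | case1 => rfl
  | case2 p a b c iha ihb ihc ihd =>
    have h1 : (fun l => rowOp t (1 :: l) F) = fun l => rowOp t l (fun r => F (0 :: r)) := rfl
    have h2 : (fun l => rowOp t (2 :: l) F) = fun l => rowOp t l (fun r => F (1 :: r)) := rfl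
    have hs : (fun l => squareOp t F (0 :: 0 :: l)) =
        fun l => t * rowOp t l (fun r => F (2 :: 2 :: 2 :: r)) := rfl
    have h3 : (match a with
        | node _ (node _ d _ _) _ _ =>
          node [] zero zero (node [] zero zero d.push.shift)
        | _ => zero).eval t (fun l => F (2 :: l)) = a.eval t (squareOp t F) := by
      rcases a with _ | ⟨p1, _ | ⟨p2, d, b2, c2⟩, b1, c1⟩
      · rfl
      · simp [eval, eval_fun_zero, squareOp]
      · simp only at ihd
        simp only [eval, eval_shift, ihd, evalList, hs, eval_fun_mul]
        simp [squareOp, eval_fun_zero]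
    simp only [push_node, eval, eval_add, rowOp_zero_cons, h1, h2, eval_fun_add, iha, ihb, ihc, h3]
    simp only [rowOp]
    ring

theorem eval_flat (x : Comb) : x.eval t flat = evalList t x.flatPart := by
  induction x with
  | zero => rfl
  | node p a b c iha ihb ihc =>
    simp [eval, flatPart, evalList_addList, eval_fun_zero, iha, flat]

theorem eval_single (p : List ℤ) (n : ℕ) (F : List ℕ → R) :
    (single p n).eval t F = evalList t p * F (List.replicate n 0) := by
  induction n generalizing F with
  | zero => simp [single, eval]
  | succ n ih => simp [single, eval, ih, evalList, List.replicate_succ]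

theorem eval_of_isZero {x : Comb} (h : x.isZero = true) (F : List ℕ → R) : x.eval t F = 0 := by
  induction x generalizing F with
  | zero => rfl
  | node p a b c iha ihb ihc =>
    simp only [isZero, Bool.and_eq_true] at h
    simp [eval, iha h.1.1.2, ihb h.1.2, ihc h.2, evalList_eq_of_eqList t h.1.1.1, evalList]

end

/-- Long division: whether `(∑ q j * z ^ j) * F 0ⁿ + x = ∑ p j * z ^ j` follows from the transfer
system. Here `x` is the combination that the current power of `z` multiplies. Each step adds `q j`
times the flat word `0ⁿ`, splits off the constant term, which has to agree with `p j`, and pushes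
the rest forward; nothing may be left at the end. -/
def divides (n : ℕ) : List (List ℤ) → List (List ℤ) → Comb → Bool
  | [], [], x => x.isZero
  | q :: qs, p :: ps, x =>
    let y := add (single q n) x
    eqList p y.flatPart && divides n qs ps y.push
  | _, _, _ => false

/-- A successful division proves the identity for every solution of the transfer system. -/
theorem evalList₂_mul_of_divides {R : Type*} [CommRing R] {z t : R} {F : List ℕ → R}
    (hF : IsTransferSolution z t F) {n : ℕ} {qs ps : List (List ℤ)} {x : Comb}
    (h : divides n qs ps x = true) :
    evalList₂ z t qs * F (List.replicate n 0) + x.eval t F = evalList₂ z t ps := by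
  induction qs generalizing ps x with
  | nil =>
    cases ps with
    | nil => simp [evalList₂, eval_of_isZero t h]
    | cons p ps => simp [divides] at h
  | cons q qs ih =>
    cases ps with
    | nil => simp [divides] at h
    | cons p ps =>
      simp only [divides, Bool.and_eq_true] at h
      obtain ⟨h1, h2⟩ := h
      have h2 := ih h2
      set y := add (single q n) x with hy
      have e1 : y.eval t F = evalList t q * F (List.replicate n 0) + x.eval t F := by
        rw [hy, eval_add, eval_single]
      have e2 : y.eval t F = evalList t p + z * y.push.eval t F := by
        conv_lhs => rw [show F = fun l => flat l + z * rowOp t l F from funext hF]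
        rw [eval_fun_add, eval_flat, eval_fun_mul, eval_push, evalList_eq_of_eqList t h1]
      simp only [evalList₂]
      linear_combination z * h2 - e1 + e2

end Comb

/-! ### The four widths -/

/-- The coefficients of `den6`. -/
def denCoeffs6 : List (List ℤ) :=
  [[1], [-1], [0, -1], [0, -3, -2], [0, 0, -1], [0, 0, 2, 1], [0, 0, 0, 2, 1]]

/-- The coefficients of `num6`, padded to the length of `denCoeffs6`. -/
def numCoeffs6 : List (List ℤ) :=
  [[1], [], [0, -1], [0, 0, -1], [], [], []]

/-- The coefficients of `den7`. -/
def denCoeffs7 : List (List ℤ) :=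
  [[1], [-1], [0, -1], [0, -4, -6], [0, 0, -4], [0, 0, 0, 2], [0, 0, 0, 2, 10], [0, 0, 0, 1, 4],
   [0, 0, 0, 0, 1, 3], [0, 0, 0, 0, 0, -1, -3]]

/-- The coefficients of `num7`, padded to the length of `denCoeffs7`. -/
def numCoeffs7 : List (List ℤ) :=
  [[1], [], [0, -1], [0, 0, -3], [0, 0, -1], [0, 0, 0, -1], [0, 0, 0, 0, 1], [], [], []]

/-- The coefficients of `den8`. -/
def denCoeffs8 : List (List ℤ) :=
  [[1], [-1], [0, -2], [0, -4, -12], [0, 0, -7], [0, 0, 1, 13], [0, 0, 0, 4, 41],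
   [0, 0, 0, 1, 13], [0, 0, 0, 0, 2, -7], [0, 0, 0, 0, 0, -7, -31], [0, 0, 0, 0, 0, 0, -13],
   [0, 0, 0, 0, 0, 0, 0, 6], [0, 0, 0, 0, 0, 0, 0, 0, 6]]

/-- The coefficients of `num8`, padded to the length of `denCoeffs8`. -/
def numCoeffs8 : List (List ℤ) :=
  [[1], [], [0, -2], [0, 0, -6], [0, 0, -1], [0, 0, 0, 1], [0, 0, 0, 1, 5], [0, 0, 0, 0, 2],
   [0, 0, 0, 0, 0, -1], [0, 0, 0, 0, 0, 0, -1], [], [], []]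

/-- The coefficients of `den9`. -/
def denCoeffs9 : List (List ℤ) :=
  [[1], [-1], [0, -2], [0, -5, -22, -6], [0, 0, -12, -8], [0, 0, -2, 13, 7],
   [0, 0, 0, 4, 142, 96, 15], [0, 0, 0, 4, 84, 145, 27], [0, 0, 0, 0, 14, 70, -28, -12],
   [0, 0, 0, 0, 2, -1, -282, -435, -176, -20], [0, 0, 0, 0, 0, 4, -110, -431, -238, -23],
   [0, 0, 0, 0, 0, 0, -23, -147, -120, 34, 15],
   [0, 0, 0, 0, 0, 0, 0, -38, -1, 417, 526, 175, 15],
   [0, 0, 0, 0, 0, 0, 0, 0, 52, 254, 446, 114, 2],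
   [0, 0, 0, 0, 0, 0, 0, 0, 0, 34, 264, 190, -25, -13],
   [0, 0, 0, 0, 0, 0, 0, 0, 0, 0, 6, 14, -211, -371, -99, -6],
   [0, 0, 0, 0, 0, 0, 0, 0, 0, 0, 0, 29, -165, -122, 4, 3],
   [0, 0, 0, 0, 0, 0, 0, 0, 0, 0, 0, 0, -38, -42, -102, 18, 6],
   [0, 0, 0, 0, 0, 0, 0, 0, 0, 0, 0, 0, 0, -15, -19, 98, 153, 29, 1],
   [0, 0, 0, 0, 0, 0, 0, 0, 0, 0, 0, 0, 0, 0, 1, 25, -4, -3],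
   [0, 0, 0, 0, 0, 0, 0, 0, 0, 0, 0, 0, 0, 0, 0, -7, -36, 21, -2, -1],
   [0, 0, 0, 0, 0, 0, 0, 0, 0, 0, 0, 0, 0, 0, 0, 0, 7, -5, -51, -29, -3],
   [0, 0, 0, 0, 0, 0, 0, 0, 0, 0, 0, 0, 0, 0, 0, 0, 0, 0, 0, -6, -1],
   [0, 0, 0, 0, 0, 0, 0, 0, 0, 0, 0, 0, 0, 0, 0, 0, 0, 0, 0, 7, -6, -1],
   [0, 0, 0, 0, 0, 0, 0, 0, 0, 0, 0, 0, 0, 0, 0, 0, 0, 0, 0, 0, 0, 7, 1]]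

/-- The coefficients of `num9`, padded to the length of `denCoeffs9`. -/
def numCoeffs9 : List (List ℤ) :=
  [[1], [], [0, -2], [0, 0, -12, -5], [0, 0, -4, -7], [0, 0, 0, -2, 5], [0, 0, 0, 2, 32, 40, 10],
   [0, 0, 0, 0, 12, 40, 12], [0, 0, 0, 0, 2, 13, 8, -7], [0, 0, 0, 0, 0, 4, -2, -53, -57, -10],
   [0, 0, 0, 0, 0, 0, -6, -29, -50, -3], [0, 0, 0, 0, 0, 0, 0, -4, -32, -19, 8],
   [0, 0, 0, 0, 0, 0, 0, 0, -1, -4, 32, 45, 5], [0, 0, 0, 0, 0, 0, 0, 0, 0, -4, 23, 12, -2],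
   [0, 0, 0, 0, 0, 0, 0, 0, 0, 0, 5, 6, 13, -5],
   [0, 0, 0, 0, 0, 0, 0, 0, 0, 0, 0, 2, 2, -14, -19, -1],
   [0, 0, 0, 0, 0, 0, 0, 0, 0, 0, 0, 0, 0, -4, 1],
   [0, 0, 0, 0, 0, 0, 0, 0, 0, 0, 0, 0, 0, 1, 5, -4, 1],
   [0, 0, 0, 0, 0, 0, 0, 0, 0, 0, 0, 0, 0, 0, -1, 1, 7, 3],
   [0, 0, 0, 0, 0, 0, 0, 0, 0, 0, 0, 0, 0, 0, 0, 0, 0, 1],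
   [0, 0, 0, 0, 0, 0, 0, 0, 0, 0, 0, 0, 0, 0, 0, 0, 0, -1, 1],
   [0, 0, 0, 0, 0, 0, 0, 0, 0, 0, 0, 0, 0, 0, 0, 0, 0, 0, 0, -1], [], [], []]

theorem divides6 : Comb.divides 6 denCoeffs6 numCoeffs6 .zero = true := by decide +kernel

theorem divides7 : Comb.divides 7 denCoeffs7 numCoeffs7 .zero = true := by decide +kernel

theorem divides8 : Comb.divides 8 denCoeffs8 numCoeffs8 .zero = true := by decide +kernel

theorem divides9 : Comb.divides 9 denCoeffs9 numCoeffs9 .zero = true := by decide +kernel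

section
variable {R : Type*} [CommRing R] (z t : R)

theorem evalList₂_denCoeffs6 : evalList₂ z t denCoeffs6 = den6 z t := by
  simp only [denCoeffs6, evalList₂, evalList, den6]
  push_cast
  ring

theorem evalList₂_numCoeffs6 : evalList₂ z t numCoeffs6 = num6 z t := by
  simp only [numCoeffs6, evalList₂, evalList, num6]
  push_cast
  ring

theorem evalList₂_denCoeffs7 : evalList₂ z t denCoeffs7 = den7 z t := by
  simp only [denCoeffs7, evalList₂, evalList, den7]
  push_cast
  ring

theorem evalList₂_numCoeffs7 : evalList₂ z t numCoeffs7 = num7 z t := by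
  simp only [numCoeffs7, evalList₂, evalList, num7]
  push_cast
  ring

theorem evalList₂_denCoeffs8 : evalList₂ z t denCoeffs8 = den8 z t := by
  simp only [denCoeffs8, evalList₂, evalList, den8]
  push_cast
  ring

theorem evalList₂_numCoeffs8 : evalList₂ z t numCoeffs8 = num8 z t := by
  simp only [numCoeffs8, evalList₂, evalList, num8]
  push_cast
  ring

theorem evalList₂_denCoeffs9 : evalList₂ z t denCoeffs9 = den9 z t := by
  simp only [denCoeffs9, evalList₂, evalList, den9, den9a, den9b, den9c, den9d]
  push_cast
  ring

theorem evalList₂_numCoeffs9 : evalList₂ z t numCoeffs9 = num9 z t := by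
  simp only [numCoeffs9, evalList₂, evalList, num9, num9a, num9b, num9c]
  push_cast
  ring

theorem den6_mul {F : List ℕ → R} (hF : IsTransferSolution z t F) :
    den6 z t * F (List.replicate 6 0) = num6 z t := by
  simpa [Comb.eval, evalList₂_denCoeffs6, evalList₂_numCoeffs6] using
    Comb.evalList₂_mul_of_divides hF divides6

theorem den7_mul {F : List ℕ → R} (hF : IsTransferSolution z t F) :
    den7 z t * F (List.replicate 7 0) = num7 z t := by
  simpa [Comb.eval, evalList₂_denCoeffs7, evalList₂_numCoeffs7] using
    Comb.evalList₂_mul_of_divides hF divides7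

theorem den8_mul {F : List ℕ → R} (hF : IsTransferSolution z t F) :
    den8 z t * F (List.replicate 8 0) = num8 z t := by
  simpa [Comb.eval, evalList₂_denCoeffs8, evalList₂_numCoeffs8] using
    Comb.evalList₂_mul_of_divides hF divides8

theorem den9_mul {F : List ℕ → R} (hF : IsTransferSolution z t F) :
    den9 z t * F (List.replicate 9 0) = num9 z t := by
  simpa [Comb.eval, evalList₂_denCoeffs9, evalList₂_numCoeffs9] using
    Comb.evalList₂_mul_of_divides hF divides9

end

theorem genFun_eq_of_mul {n : ℕ} {P Q : MvPowerSeries (Fin 2) ℚ}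
    (hQ : MvPowerSeries.constantCoeff Q = 1)
    (h : ∀ F : List ℕ → MvPowerSeries (Fin 2) ℚ,
      IsTransferSolution (MvPowerSeries.X 0) (MvPowerSeries.X 1) F →
        Q * F (List.replicate n 0) = P) :
    genFun n 3 = P * Q⁻¹ := by
  rw [MvPowerSeries.eq_mul_inv_iff_mul_eq (by simp [hQ]), mul_comm, genFun_eq_seriesHom]
  exact h _ isTransferSolution_seriesHom

theorem rowSumGenFun_eq_of_mul {n : ℕ} {P Q : PowerSeries ℚ}
    (hQ : PowerSeries.constantCoeff Q = 1)
    (h : ∀ F : List ℕ → PowerSeries ℚ, IsTransferSolution PowerSeries.X 1 F →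
      Q * F (List.replicate n 0) = P) :
    rowSumGenFun n 3 = P * Q⁻¹ := by
  rw [PowerSeries.eq_mul_inv_iff_mul_eq (by simp [hQ]), mul_comm, rowSumGenFun_eq_rowSeriesHom]
  exact h _ isTransferSolution_rowSeriesHom

section
variable {R : Type*} [CommRing R] (w : R)

theorem den6_one : den6 w 1 = rowDen6 w := by
  simp only [den6, rowDen6]
  ring

theorem num6_one : num6 w 1 = rowNum6 w := by
  simp only [num6, rowNum6]
  ring

theorem den7_one : den7 w 1 = rowDen7 w := by
  simp only [den7, rowDen7]
  ring

theorem num7_one : num7 w 1 = rowNum7 w := by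
  simp only [num7, rowNum7]
  ring

theorem den8_one : den8 w 1 = rowDen8 w := by
  simp only [den8, rowDen8]
  ring

theorem num8_one : num8 w 1 = rowNum8 w := by
  simp only [num8, rowNum8]
  ring

theorem den9_one : den9 w 1 = rowDen9 w := by
  simp only [den9, den9a, den9b, den9c, den9d, rowDen9]
  ring

theorem num9_one : num9 w 1 = rowNum9 w := by
  simp only [num9, num9a, num9b, num9c, rowNum9]
  ring

end

end SquareTiling

/-- Formal power series identities; the denominators have constant term `1`, so the inverses
are genuine inverses in the power series rings. Here `z` and `t` are the two variables of the bivariate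
generating functions and `w` is the variable of the row sum generating functions. -/
theorem mainTheorem5
    (z t : MvPowerSeries (Fin 2) ℚ) (hz : z = MvPowerSeries.X 0) (ht : t = MvPowerSeries.X 1)
    (w : PowerSeries ℚ) (hw : w = PowerSeries.X) :
    SquareTiling.genFun 6 3 = SquareTiling.num6 z t * (SquareTiling.den6 z t)⁻¹ ∧
    SquareTiling.rowSumGenFun 6 3 = SquareTiling.rowNum6 w * (SquareTiling.rowDen6 w)⁻¹ ∧
    SquareTiling.genFun 7 3 = SquareTiling.num7 z t * (SquareTiling.den7 z t)⁻¹ ∧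
    SquareTiling.rowSumGenFun 7 3 = SquareTiling.rowNum7 w * (SquareTiling.rowDen7 w)⁻¹ ∧
    SquareTiling.genFun 8 3 = SquareTiling.num8 z t * (SquareTiling.den8 z t)⁻¹ ∧
    SquareTiling.rowSumGenFun 8 3 = SquareTiling.rowNum8 w * (SquareTiling.rowDen8 w)⁻¹ ∧
    SquareTiling.genFun 9 3 = SquareTiling.num9 z t * (SquareTiling.den9 z t)⁻¹ ∧
    SquareTiling.rowSumGenFun 9 3 = SquareTiling.rowNum9 w * (SquareTiling.rowDen9 w)⁻¹ := by
  subst hz ht hw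
  refine ⟨?_, ?_, ?_, ?_, ?_, ?_, ?_, ?_⟩
  · refine SquareTiling.genFun_eq_of_mul ?_ fun F hF => SquareTiling.den6_mul _ _ hF
    simp [SquareTiling.den6]
  · refine SquareTiling.rowSumGenFun_eq_of_mul ?_ fun F hF => ?_
    · simp [SquareTiling.rowDen6]
    · rw [← SquareTiling.den6_one, ← SquareTiling.num6_one]
      exact SquareTiling.den6_mul _ _ hF
  · refine SquareTiling.genFun_eq_of_mul ?_ fun F hF => SquareTiling.den7_mul _ _ hF
    simp [SquareTiling.den7]
  · refine SquareTiling.rowSumGenFun_eq_of_mul ?_ fun F hF => ?_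
    · simp [SquareTiling.rowDen7]
    · rw [← SquareTiling.den7_one, ← SquareTiling.num7_one]
      exact SquareTiling.den7_mul _ _ hF
  · refine SquareTiling.genFun_eq_of_mul ?_ fun F hF => SquareTiling.den8_mul _ _ hF
    simp [SquareTiling.den8]
  · refine SquareTiling.rowSumGenFun_eq_of_mul ?_ fun F hF => ?_
    · simp [SquareTiling.rowDen8]
    · rw [← SquareTiling.den8_one, ← SquareTiling.num8_one]
      exact SquareTiling.den8_mul _ _ hF
  · refine SquareTiling.genFun_eq_of_mul ?_ fun F hF => SquareTiling.den9_mul _ _ hF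
    simp [SquareTiling.den9, SquareTiling.den9a, SquareTiling.den9b,
      SquareTiling.den9c, SquareTiling.den9d]
  · refine SquareTiling.rowSumGenFun_eq_of_mul ?_ fun F hF => ?_
    · simp [SquareTiling.rowDen9]
    · rw [← SquareTiling.den9_one, ← SquareTiling.num9_one]
      exact SquareTiling.den9_mul _ _ hF
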